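/- Let $p$ be a prime number, let $(R, \mathfrak{m})$ be a regular local ring whose residue field $R/\mathfrak{m}$ has characteristic $p$, and let $\mathfrak{p}$ be a prime ideal of $R$ such that $p \in \mathfrak{p}$. Then the localization $R_{\mathfrak{p}}$ is also a regular local ring. -/

import Mathlib

open IsLocalRing

universe u

/-! This is Serre's homological argument. Over a regular local ring every finite module has finite
projective dimension; apply this to `R ⧸ 𝔭`. Localizing at `𝔭` keeps the bound and turns `R ⧸ 𝔭`
into the residue field of `R_𝔭`. Conversely, a Noetherian local ring whose residue field has finite
projective dimension is regular. Both halves are inductions on the number of generators of `𝔪`,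
dividing by a regular `x ∈ 𝔪 \ 𝔪 ^ 2`. That number then drops by exactly one, and
`hasProjectiveDimensionLE_quotSMulTop_iff` carries projective dimension across the quotient. -/

namespace IsLocalRing

/-! ### Embedding dimension modulo an element, and prime avoidance -/

variable {R : Type*} [CommRing R] [IsLocalRing R]

/-- The quotient of a local ring by a nonunit is local. -/
lemma quotient_span_singleton {x : R} (hx : x ∈ maximalIdeal R) :
    IsLocalRing (R ⧸ Ideal.span {x}) := by
  have : Nontrivial (R ⧸ Ideal.span {x}) := Ideal.Quotient.nontrivial_iff.mpr fun h ↦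
    (maximalIdeal.isMaximal R).ne_top (top_le_iff.mp (h ▸ (Ideal.span_singleton_le_iff_mem _).mpr hx))
  exact IsLocalRing.of_surjective' _ Ideal.Quotient.mk_surjective

lemma map_mk_maximalIdeal (I : Ideal R) [IsLocalRing (R ⧸ I)] :
    (maximalIdeal R).map (Ideal.Quotient.mk I) = maximalIdeal (R ⧸ I) := by
  have h := Ideal.comap_isMaximal_of_surjective (Ideal.Quotient.mk I)
    Ideal.Quotient.mk_surjective (K := maximalIdeal (R ⧸ I))
  rw [← IsLocalRing.eq_maximalIdeal h,
    Ideal.map_comap_of_surjective _ Ideal.Quotient.mk_surjective]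

variable [IsNoetherianRing R]

/-- When `x ∉ 𝔪 ^ 2` is written in a minimal generating set, some coefficient is a unit, so that
generator becomes redundant modulo `x`. -/
lemma spanFinrank_maximalIdeal_quotient_add_one_le {x : R} (hx : x ∈ maximalIdeal R)
    (hx2 : x ∉ maximalIdeal R ^ 2) [IsLocalRing (R ⧸ Ideal.span {x})] :
    (maximalIdeal (R ⧸ Ideal.span {x})).spanFinrank + 1 ≤ (maximalIdeal R).spanFinrank := by
  classical
  obtain ⟨s, hs, hspan⟩ :=
    Submodule.FG.exists_span_finset_card_eq_spanFinrank (maximalIdeal R).fg_of_isNoetherianRing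
  have hsm : ∀ a ∈ s, a ∈ maximalIdeal R := fun a ha ↦ hspan ▸ Submodule.subset_span ha
  obtain ⟨f, -, hf⟩ := Submodule.mem_span_finset.mp (hspan ▸ hx)
  obtain ⟨i, his, hi⟩ : ∃ i ∈ s, IsUnit (f i) := by
    by_contra! h
    refine hx2 (hf ▸ Submodule.sum_mem _ fun a ha ↦ ?_)
    rw [pow_two]
    exact Ideal.mul_mem_mul ((mem_maximalIdeal _).mpr (h a ha)) (hsm a ha)
  let π := Ideal.Quotient.mk (Ideal.span {x})
  have hmem : π i ∈ Ideal.span (π '' (s.erase i : Set R)) := by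
    obtain ⟨u, hu⟩ := hi
    have h0 : π (∑ a ∈ s, f a • a) = 0 := by
      rw [hf]; exact Ideal.Quotient.eq_zero_iff_mem.mpr (Ideal.mem_span_singleton_self x)
    rw [← Finset.add_sum_erase _ _ his, map_add, ← hu, smul_eq_mul, map_mul] at h0
    have h1 : π i = π (↑u⁻¹ : R) * -π (∑ a ∈ s.erase i, f a • a) := by
      rw [← eq_neg_iff_add_eq_zero] at h0
      rw [← h0, ← mul_assoc, ← map_mul, Units.inv_mul, map_one, one_mul]
    rw [h1, map_sum]
    refine Ideal.mul_mem_left _ _ (neg_mem (sum_mem fun a ha ↦ ?_))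
    rw [smul_eq_mul, map_mul]
    exact Ideal.mul_mem_left _ _ (Ideal.subset_span ⟨a, by simpa [and_comm] using ha, rfl⟩)
  have hle : maximalIdeal (R ⧸ Ideal.span {x}) = Ideal.span (π '' (s.erase i : Set R)) := by
    rw [← map_mk_maximalIdeal, ← hspan]
    change Ideal.map π (Ideal.span _) = _
    rw [Ideal.map_span]
    refine le_antisymm (Ideal.span_le.mpr ?_) (Ideal.span_mono (Set.image_mono (by simp)))
    rintro _ ⟨a, ha, rfl⟩
    by_cases hai : a = i
    · exact hai ▸ hmem
    · exact Ideal.subset_span ⟨a, by simpa [hai] using ha, rfl⟩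
  rw [← hs, ← Finset.card_erase_add_one his, hle]
  gcongr
  have hfin := (s.erase i).finite_toSet
  exact (Submodule.spanFinrank_span_le_ncard_of_finite (hfin.image π)).trans
    ((Set.ncard_image_le hfin).trans_eq (Set.ncard_coe_finset _))

lemma spanFinrank_maximalIdeal_le_quotient_add_one {x : R} (hx : x ∈ maximalIdeal R)
    [IsLocalRing (R ⧸ Ideal.span {x})] :
    (maximalIdeal R).spanFinrank ≤ (maximalIdeal (R ⧸ Ideal.span {x})).spanFinrank + 1 := by
  classical
  obtain ⟨s, hs, hspan⟩ := Submodule.FG.exists_span_finset_card_eq_spanFinrank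
    (maximalIdeal (R ⧸ Ideal.span {x})).fg_of_isNoetherianRing
  let π := Ideal.Quotient.mk (Ideal.span {x})
  let t := s.image (Function.surjInv (f := π) Ideal.Quotient.mk_surjective)
  have ht : π '' (t : Set R) = s := by
    rw [Finset.coe_image, ← Set.image_comp, Function.comp_surjInv, Set.image_id]
  have h : maximalIdeal R = Ideal.span (insert x t : Finset R) := by
    have h1 : maximalIdeal R = ((maximalIdeal R).map π).comap π := by
      rw [Ideal.comap_map_of_surjective π Ideal.Quotient.mk_surjective]
      refine (sup_eq_left.mpr ?_).symm
      rw [← RingHom.ker_eq_comap_bot, Ideal.mk_ker]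
      exact (Ideal.span_singleton_le_iff_mem _).mpr hx
    rw [h1, map_mk_maximalIdeal, ← hspan, ← ht]
    change Ideal.comap π (Ideal.span _) = _
    rw [← Ideal.map_span, Ideal.comap_map_of_surjective π Ideal.Quotient.mk_surjective,
      ← RingHom.ker_eq_comap_bot, Ideal.mk_ker, Finset.coe_insert, Ideal.span_insert, sup_comm]
  rw [h, ← hs]
  refine (Submodule.spanFinrank_span_le_ncard_of_finite (Finset.finite_toSet _)).trans ?_
  rw [Set.ncard_coe_finset]
  exact (Finset.card_insert_le _ _).trans (Nat.add_le_add_right Finset.card_image_le 1)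

/-- Prime avoidance: outside a finite set of primes different from the maximal ideal there is
an element of `𝔪 \ 𝔪 ^ 2`. -/
lemma exists_mem_maximalIdeal_notMem_sq (hm : maximalIdeal R ≠ ⊥) {S : Set (Ideal R)}
    (hS : S.Finite) (hp : ∀ q ∈ S, q.IsPrime) (hne : maximalIdeal R ∉ S) :
    ∃ x ∈ maximalIdeal R, x ∉ maximalIdeal R ^ 2 ∧ ∀ q ∈ S, x ∉ q := by
  classical
  by_contra! h
  have hsub : (maximalIdeal R : Set R) ⊆
      ⋃ i ∈ (↑(insert (maximalIdeal R ^ 2) hS.toFinset) : Set (Ideal R)), (id i : Ideal R) := by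
    intro x hx
    by_cases hx2 : x ∈ maximalIdeal R ^ 2
    · exact Set.mem_biUnion (by simp) hx2
    · obtain ⟨q, hq, hxq⟩ := h x hx hx2
      exact Set.mem_biUnion (by simp [hq]) hxq
  -- Prime avoidance tolerates two non-prime ideals; `𝔪 ^ 2` fills both slots.
  rw [Ideal.subset_union_prime (maximalIdeal R ^ 2) (maximalIdeal R ^ 2)] at hsub
  · obtain ⟨i, hi, hle⟩ := hsub
    rcases Finset.mem_insert.mp hi with rfl | hi
    · refine hm (Submodule.eq_bot_of_le_smul_of_le_jacobson_bot (maximalIdeal R) _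
        (maximalIdeal R).fg_of_isNoetherianRing (by simpa [pow_two] using hle) ?_)
      exact maximalIdeal_le_jacobson _
    · have hi' : i ∈ S := by simpa using hi
      have := (hp i hi').ne_top
      exact hne ((maximalIdeal.isMaximal R).eq_of_le this hle ▸ hi')
  · intro i hi h1 _
    exact hp i (by simpa [h1] using hi)

end IsLocalRing

/-! ### Regularity modulo an element; regular local rings are domains -/

namespace IsRegularLocalRing

variable {R : Type*} [CommRing R]

/-- The generator count drops by at least one, the dimension by at most one. -/
lemma quotient_span_singleton [IsRegularLocalRing R] {x : R} (hx : x ∈ maximalIdeal R)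
    (hx2 : x ∉ maximalIdeal R ^ 2) : IsRegularLocalRing (R ⧸ Ideal.span {x}) := by
  have := IsLocalRing.quotient_span_singleton hx
  refine of_spanFinrank_maximalIdeal_le _ ?_
  have h1 := spanFinrank_maximalIdeal_quotient_add_one_le hx hx2
  have h2 := ringKrullDim_le_ringKrullDim_quotient_add_card ({x} : Finset R)
    (by simpa [ringJacobson_eq_maximalIdeal] using hx)
  rw [← spanFinrank_maximalIdeal, Finset.coe_singleton] at h2
  have h3 := (Nat.cast_le (α := WithBot ℕ∞)).mpr h1
  simp only [Finset.card_singleton, Nat.cast_one, Nat.cast_add] at h2 h3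
  exact (ENat.WithBot.add_le_add_one_right_iff).mp (h3.trans h2)

lemma of_quotient_span_singleton [IsLocalRing R] [IsNoetherianRing R] {x : R}
    (hx : x ∈ maximalIdeal R) (hreg : x ∈ nonZeroDivisors R)
    [IsRegularLocalRing (R ⧸ Ideal.span {x})] : IsRegularLocalRing R := by
  refine of_spanFinrank_maximalIdeal_le _ ?_
  rw [← ringKrullDim_quotient_span_singleton_succ_eq_ringKrullDim_of_mem_nonZeroDivisors hreg hx,
    ← spanFinrank_maximalIdeal]
  exact_mod_cast spanFinrank_maximalIdeal_le_quotient_add_one hx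

lemma isDomain_of_spanFinrank_eq (n : ℕ) : ∀ (R : Type u) [CommRing R] [IsRegularLocalRing R],
    (maximalIdeal R).spanFinrank = n → IsDomain R := by
  induction n with
  | zero =>
    intro R _ _ h
    have hm : maximalIdeal R = ⊥ := (Submodule.spanFinrank_eq_zero_iff_eq_bot
      (maximalIdeal R).fg_of_isNoetherianRing).mp h
    exact (IsLocalRing.isField_iff_maximalIdeal_eq.mpr hm).isDomain
  | succ n ih =>
    intro R _ _ h
    have hm : maximalIdeal R ≠ ⊥ := fun h0 ↦ by simp [h0] at h
    have hdim := spanFinrank_maximalIdeal (R := R)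
    obtain ⟨x, hx, hx2, hxq⟩ := exists_mem_maximalIdeal_notMem_sq hm
      (minimalPrimes.finite_of_isNoetherianRing R) (fun q hq ↦ hq.1.1) (fun hmin ↦ by
        have h0 : (maximalIdeal R).height = 0 := Ideal.height_eq_zero_iff.mpr hmin
        rw [h, ← maximalIdeal_height_eq_ringKrullDim, h0] at hdim
        norm_cast at hdim)
    have hreg := quotient_span_singleton hx hx2
    have hdom : IsDomain (R ⧸ Ideal.span {x}) := ih _ (by
      have h1 := spanFinrank_maximalIdeal_quotient_add_one_le hx hx2
      have h2 := spanFinrank_maximalIdeal_le_quotient_add_one hx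
      omega)
    have hprime := (Ideal.Quotient.isDomain_iff_prime _).mp hdom
    -- As `x ∉ q ⊆ (x)` and `q` is prime, `q = x q`, so Nakayama gives `q = 0`.
    obtain ⟨q, hq, hqx⟩ := Ideal.exists_minimalPrimes_le (bot_le : ⊥ ≤ Ideal.span {x})
    have hqp : q.IsPrime := hq.1.1
    have hq0 : q = ⊥ := by
      refine Submodule.eq_bot_of_le_smul_of_le_jacobson_bot (maximalIdeal R) _
        q.fg_of_isNoetherianRing (fun y hy ↦ ?_) (maximalIdeal_le_jacobson _)
      obtain ⟨a, rfl⟩ := Ideal.mem_span_singleton'.mp (hqx hy)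
      rw [mul_comm]
      exact Ideal.mul_mem_mul hx ((hqp.mem_or_mem hy).resolve_right (hxq q hq))
    subst hq0
    exact (RingEquiv.quotientBot R).symm.isDomain

/-- A regular local ring is a domain. -/
lemma isDomain [IsRegularLocalRing R] : IsDomain R :=
  isDomain_of_spanFinrank_eq _ R rfl

end IsRegularLocalRing

open CategoryTheory Module

/-! ### Projective dimension over local rings -/

namespace ModuleCat

variable {R : Type u} [CommRing R]

lemma hasProjectiveDimensionLE_zero_iff (M : Type u) [AddCommGroup M] [Module R M] :
    HasProjectiveDimensionLE (of R M) 0 ↔ Module.Projective R M := by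
  rw [← projective_iff_hasProjectiveDimensionLE_zero, ← IsProjective.iff_projective]

lemma hasProjectiveDimensionLE_succ_iff_of_exact {K P M : Type u} [AddCommGroup K] [Module R K]
    [AddCommGroup P] [Module R P] [AddCommGroup M] [Module R M] [Module.Projective R P]
    {f : K →ₗ[R] P} {g : P →ₗ[R] M} (hf : Function.Injective f) (hfg : Function.Exact f g)
    (hg : Function.Surjective g) (n : ℕ) :
    HasProjectiveDimensionLE (of R M) (n + 1) ↔ HasProjectiveDimensionLE (of R K) n := by
  let S : ShortComplex (ModuleCat.{u} R) :=
    ShortComplex.mk (ofHom f) (ofHom g) (by ext a; exact hfg.apply_apply_eq_zero a)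
  have hS : S.ShortExact :=
    { exact := (ShortComplex.ShortExact.moduleCat_exact_iff_function_exact S).mpr hfg
      mono_f := (ModuleCat.mono_iff_injective _).mpr hf
      epi_g := (ModuleCat.epi_iff_surjective _).mpr hg }
  exact hS.hasProjectiveDimensionLT_X₃_iff n ((IsProjective.iff_projective _).mp ‹_›)

lemma hasProjectiveDimensionLE_of_retract {M N : Type u} [AddCommGroup M] [Module R M]
    [AddCommGroup N] [Module R N] (i : M →ₗ[R] N) (r : N →ₗ[R] M) (h : r ∘ₗ i = LinearMap.id)
    {n : ℕ} (hN : HasProjectiveDimensionLE (of R N) n) : HasProjectiveDimensionLE (of R M) n :=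
  (Retract.mk (ofHom i) (ofHom r) (by rw [← ofHom_comp, h]; rfl) :
    Retract (of R M) (of R N)).hasProjectiveDimensionLT (n + 1)

lemma hasProjectiveDimensionLE_mono {M : Type u} [AddCommGroup M] [Module R M] {m n : ℕ}
    (hmn : m ≤ n) (h : HasProjectiveDimensionLE (of R M) m) :
    HasProjectiveDimensionLE (of R M) n :=
  hasProjectiveDimensionLT_of_ge (of R M) (m + 1) (n + 1) (by lia)

lemma ker_tensorProductMk_residueField [IsLocalRing R] (Q : Type*) [AddCommGroup Q]
    [Module R Q] :
    LinearMap.ker (TensorProduct.mk R (ResidueField R) Q 1) = maximalIdeal R • ⊤ :=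
  LinearMap.ker_tensorProductMk Q (I := maximalIdeal R)

/-- A finite free submodule of a finite free module over a local ring of depth zero is a
direct summand. -/
lemma exists_leftInverse_of_socle_ne_zero [IsLocalRing R] {K P : Type*} [AddCommGroup K] [Module R K]
    [AddCommGroup P] [Module R P] [Module.Free R K] [Module.Finite R K] [Module.Free R P]
    [Module.Finite R P] {z : R} (hz : z ≠ 0) (hzm : ∀ a ∈ maximalIdeal R, z * a = 0)
    (f : K →ₗ[R] P) (hf : Function.Injective f) : ∃ g, g ∘ₗ f = LinearMap.id := by
  rw [IsLocalRing.split_injective_iff_lTensor_residueField_injective, injective_iff_map_eq_zero]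
  intro t ht
  obtain ⟨y, rfl⟩ := TensorProduct.mk_surjective R K (ResidueField R) residue_surjective t
  have h1 : f y ∈ maximalIdeal R • (⊤ : Submodule R P) := by
    rw [← ker_tensorProductMk_residueField]
    simpa using ht
  -- The socle element `z` kills `𝔪 P`, hence `f y`, hence `y`; a unit coordinate of `y` would force
  -- `z = 0`.
  have h2 : z • y = 0 := by
    refine hf ?_
    rw [map_smul, map_zero]
    refine Submodule.smul_induction_on h1 (fun a ha p _ ↦ ?_) fun p q hp hq ↦ ?_
    · rw [← mul_smul, hzm a ha, zero_smul]
    · rw [smul_add, hp, hq, add_zero]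
  have h3 : y ∈ maximalIdeal R • (⊤ : Submodule R K) := by
    let b := Module.Free.chooseBasis R K
    rw [← b.sum_repr y]
    refine Submodule.sum_mem _ fun i _ ↦ Submodule.smul_mem_smul ?_ trivial
    rw [mem_maximalIdeal]
    intro hu
    have h4 : z * b.repr y i = 0 := by
      simpa using DFunLike.congr_fun (congrArg b.repr h2) i
    exact hz (hu.mul_left_eq_zero.mp h4)
  rw [← ker_tensorProductMk_residueField] at h3
  exact h3

variable [IsNoetherianRing R]

/-- Over a local ring, the projective dimension of `N ⧸ x N` over `R ⧸ x R` is that of `N`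
over `R`, if `x` is regular on `R` and `N`. -/
lemma hasProjectiveDimensionLE_quotSMulTop_iff [IsLocalRing R] {x : R}
    (hx : x ∈ maximalIdeal R) (hreg : x ∈ nonZeroDivisors R) (n : ℕ) :
    ∀ (N : Type u) [AddCommGroup N] [Module R N] [Module.Finite R N], IsSMulRegular N x →
      (HasProjectiveDimensionLE (of (R ⧸ Ideal.span {x}) (QuotSMulTop x N)) n ↔
        HasProjectiveDimensionLE (of R N) n) := by
  have := IsLocalRing.quotient_span_singleton hx
  induction n with
  | zero =>
    intro N _ _ _ hN
    have := Module.finitePresentation_of_finite R N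
    have : Module.Finite (R ⧸ Ideal.span {x}) (QuotSMulTop x N) :=
      Module.Finite.of_restrictScalars_finite R _ _
    rw [hasProjectiveDimensionLE_zero_iff, hasProjectiveDimensionLE_zero_iff]
    have h := Module.free_quotSMulTop_iff_free R N (maximalIdeal_le_jacobson _ hx) hN
    refine ⟨fun _ ↦ ?_, fun _ ↦ ?_⟩
    · have := h.mp Module.free_of_flat_of_isLocalRing
      infer_instance
    · have := h.mpr Module.free_of_flat_of_isLocalRing
      infer_instance
  | succ n ih =>
    intro N _ _ _ hN
    obtain ⟨P, _, _, _, _, f, hf⟩ := Module.exists_finite_presentation R N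
    have hP : IsSMulRegular P x := Module.Flat.isSMulRegular_of_nonZeroDivisors hreg
    have hK : IsSMulRegular (LinearMap.ker f) x := hP.submodule _ _
    -- The zero map makes a four-term sequence; regularity of `x` on `N` then keeps the left map
    -- injective modulo `x`.
    have hinj : Function.Exact (0 : LinearMap.ker f →ₗ[R] LinearMap.ker f)
        (LinearMap.ker f).subtype := by
      rw [LinearMap.exact_zero_iff_injective]
      exact (LinearMap.ker f).injective_subtype
    have hex := LinearMap.exact_subtype_ker_map f
    have h1 := QuotSMulTop.map_first_exact_on_four_term_exact_of_isSMulRegular_last hinj hex hN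
    rw [map_zero, LinearMap.exact_zero_iff_injective] at h1
    have h2 := QuotSMulTop.map_exact x hex hf
    have h3 := QuotSMulTop.map_surjective x hf
    rw [hasProjectiveDimensionLE_succ_iff_of_exact (LinearMap.ker f).injective_subtype hex hf,
      ← ih _ hK]
    have hs : Function.Surjective (algebraMap R (R ⧸ Ideal.span {x})) :=
      Ideal.Quotient.mk_surjective
    exact hasProjectiveDimensionLE_succ_iff_of_exact
      (f := (QuotSMulTop.map x (LinearMap.ker f).subtype).extendScalarsOfSurjective hs)
      (g := (QuotSMulTop.map x f).extendScalarsOfSurjective hs) h1 h2 h3 n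

/-- `M` may have `x`-torsion, but its first syzygy lies in a free module over a domain, so induction
over `R ⧸ (x)` applies to the syzygy. -/
lemma exists_hasProjectiveDimensionLE_of_isRegularLocalRing (d : ℕ) :
    ∀ (R : Type u) [CommRing R] [IsRegularLocalRing R], (maximalIdeal R).spanFinrank = d →
      ∀ (M : Type u) [AddCommGroup M] [Module R M] [Module.Finite R M],
        ∃ n, HasProjectiveDimensionLE (of R M) n := by
  induction d with
  | zero =>
    intro R _ _ h M _ _ _
    have hm : maximalIdeal R = ⊥ := (Submodule.spanFinrank_eq_zero_iff_eq_bot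
      (maximalIdeal R).fg_of_isNoetherianRing).mp h
    let := (IsLocalRing.isField_iff_maximalIdeal_eq.mpr hm).toField
    exact ⟨0, (hasProjectiveDimensionLE_zero_iff M).mpr inferInstance⟩
  | succ d ih =>
    intro R _ _ h M _ _ _
    have hm : maximalIdeal R ≠ ⊥ := fun h0 ↦ by simp [h0] at h
    obtain ⟨x, hx, hx2, -⟩ := exists_mem_maximalIdeal_notMem_sq hm Set.finite_empty
      (by simp) (by simp)
    have hdom := IsRegularLocalRing.isDomain (R := R)
    have hreg : x ∈ nonZeroDivisors R := mem_nonZeroDivisors_of_ne_zero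
      fun h0 ↦ hx2 (h0 ▸ zero_mem _)
    have := IsRegularLocalRing.quotient_span_singleton hx hx2
    obtain ⟨P, _, _, _, _, f, hf⟩ := Module.exists_finite_presentation R M
    have hP : IsSMulRegular P x := Module.Flat.isSMulRegular_of_nonZeroDivisors hreg
    have hK : IsSMulRegular (LinearMap.ker f) x := hP.submodule _ _
    have : Module.Finite (R ⧸ Ideal.span {x}) (QuotSMulTop x (LinearMap.ker f)) :=
      Module.Finite.of_restrictScalars_finite R _ _
    obtain ⟨n, hn⟩ := ih (R ⧸ Ideal.span {x}) (by
      have h1 := spanFinrank_maximalIdeal_quotient_add_one_le hx hx2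
      have h2 := spanFinrank_maximalIdeal_le_quotient_add_one hx
      omega) (QuotSMulTop x (LinearMap.ker f))
    rw [hasProjectiveDimensionLE_quotSMulTop_iff hx hreg n _ hK] at hn
    exact ⟨n + 1, (hasProjectiveDimensionLE_succ_iff_of_exact (LinearMap.ker f).injective_subtype
      (LinearMap.exact_subtype_ker_map f) hf n).mpr hn⟩

variable [IsLocalRing R]

/-- Over a local ring of depth zero, finite modules of finite projective dimension are
projective. -/
lemma projective_of_hasProjectiveDimensionLE_of_socle_ne_zero {z : R} (hz : z ≠ 0)
    (hzm : ∀ a ∈ maximalIdeal R, z * a = 0) (n : ℕ) :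
    ∀ (N : Type u) [AddCommGroup N] [Module R N] [Module.Finite R N],
      HasProjectiveDimensionLE (of R N) n → Module.Projective R N := by
  induction n with
  | zero => exact fun N _ _ _ h ↦ (hasProjectiveDimensionLE_zero_iff N).mp h
  | succ n ih =>
    intro N _ _ _ h
    obtain ⟨P, _, _, _, _, f, hf⟩ := Module.exists_finite_presentation R N
    have hex := LinearMap.exact_subtype_ker_map f
    have hK := ih _ ((hasProjectiveDimensionLE_succ_iff_of_exact
      (LinearMap.ker f).injective_subtype hex hf n).mp h)
    have : Module.Free R (LinearMap.ker f) := Module.free_of_flat_of_isLocalRing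
    have hl := exists_leftInverse_of_socle_ne_zero hz hzm _ (LinearMap.ker f).injective_subtype
    obtain ⟨s, hs⟩ := ((Function.Exact.split_tfae hex
      (LinearMap.ker f).injective_subtype hf).out 0 1).mpr hl
    exact Module.Projective.of_split s f hs

end ModuleCat

open scoped Pointwise

lemma Module.annihilator_eq_bot_of_projective {R : Type*} [CommRing R] [IsLocalRing R] (M : Type*)
    [AddCommGroup M] [Module R M] [Module.Finite R M] [Module.Projective R M] [Nontrivial M] :
    Module.annihilator R M = ⊥ := by
  have : Module.Free R M := Module.free_of_flat_of_isLocalRing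
  exact Module.annihilator_eq_bot.mpr inferInstance

namespace ModuleCat

variable {R : Type u} [CommRing R] [IsLocalRing R]

/-- `𝔪` is the first syzygy of the residue field. The bound is weakened to `n + 1` before shifting,
which avoids treating `n = 0` apart. -/
lemma hasProjectiveDimensionLE_maximalIdeal {n : ℕ}
    (h : HasProjectiveDimensionLE (of R (ResidueField R)) n) :
    HasProjectiveDimensionLE (of R (maximalIdeal R)) n :=
  (hasProjectiveDimensionLE_succ_iff_of_exact (f := (maximalIdeal R).subtype)
    (g := Algebra.linearMap R (ResidueField R)) (maximalIdeal R).injective_subtype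
    (fun a ↦ by
      rw [Algebra.linearMap_apply, ResidueField.algebraMap_eq, residue_eq_zero_iff]
      simp) residue_surjective n).mp (hasProjectiveDimensionLE_mono n.le_succ h)

/-- For `x ∈ 𝔪 \ 𝔪 ^ 2` the residue field is a direct summand of `𝔪 ⧸ x 𝔪` over `R ⧸ x R`. -/
lemma hasProjectiveDimensionLE_residueField_quotient {x : R} (hx : x ∈ maximalIdeal R)
    (hx2 : x ∉ maximalIdeal R ^ 2) [IsLocalRing (R ⧸ Ideal.span {x})] {n : ℕ}
    (h : HasProjectiveDimensionLE
      (of (R ⧸ Ideal.span {x}) (QuotSMulTop x (maximalIdeal R))) n) :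
    HasProjectiveDimensionLE (of (R ⧸ Ideal.span {x}) (ResidueField (R ⧸ Ideal.span {x}))) n := by
  let R' := R ⧸ Ideal.span {x}
  let Q := QuotSMulTop x (maximalIdeal R)
  have hs : Function.Surjective (algebraMap R R') := Ideal.Quotient.mk_surjective
  let v : CotangentSpace R := (maximalIdeal R).toCotangent ⟨x, hx⟩
  -- The class of `x` in `𝔪 ⧸ 𝔪 ^ 2` is nonzero, so some functional takes it to `1`; this induces
  -- the retraction `r`.
  obtain ⟨φ, hφ⟩ : ∃ φ : Module.Dual (ResidueField R) (CotangentSpace R), φ v = 1 := by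
    have hv : v ≠ 0 := fun h0 ↦ hx2 ((Ideal.toCotangent_eq_zero _ _).mp h0)
    obtain ⟨φ, hφ⟩ := not_forall.mp
      ((Module.forall_dual_apply_eq_zero_iff (ResidueField R) v).not.mpr hv)
    exact ⟨(φ v)⁻¹ • φ, inv_mul_cancel₀ hφ⟩
  have hle : maximalIdeal R ≤ LinearMap.ker (Algebra.linearMap R (ResidueField R')) := by
    intro a ha
    rw [LinearMap.mem_ker, Algebra.linearMap_apply,
      IsScalarTower.algebraMap_apply R R' (ResidueField R'), ResidueField.algebraMap_eq,
      residue_eq_zero_iff, ← map_mk_maximalIdeal]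
    exact Ideal.mem_map_of_mem _ ha
  let ρ : ResidueField R →ₗ[R] ResidueField R' :=
    Submodule.liftQ (maximalIdeal R) (Algebra.linearMap R (ResidueField R')) hle
  let ψ : maximalIdeal R →ₗ[R] ResidueField R' :=
    ρ ∘ₗ φ.restrictScalars R ∘ₗ (maximalIdeal R).toCotangent
  have hψ : x • (⊤ : Submodule R (maximalIdeal R)) ≤ LinearMap.ker ψ := by
    rintro _ ⟨y, -, rfl⟩
    rw [LinearMap.mem_ker, DistribSMul.toLinearMap_apply, map_smul, algebra_compatible_smul R',
      show algebraMap R R' x = 0 from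
        Ideal.Quotient.eq_zero_iff_mem.mpr (Ideal.mem_span_singleton_self x), zero_smul]
  let r : Q →ₗ[R'] ResidueField R' := (Submodule.liftQ _ ψ hψ).extendScalarsOfSurjective hs
  let q : Q := Submodule.Quotient.mk ⟨x, hx⟩
  -- For `a ∈ 𝔪`, `a x ∈ x 𝔪`; hence `1 ↦ q` is well defined on the residue field.
  have hi : maximalIdeal R' ≤ LinearMap.ker (LinearMap.toSpanSingleton R' Q q) := by
    rw [← map_mk_maximalIdeal, Ideal.map_le_iff_le_comap]
    intro a ha
    change (a • q : Q) = 0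
    rw [← Submodule.Quotient.mk_smul, Submodule.Quotient.mk_eq_zero]
    exact ⟨⟨a, ha⟩, trivial, Subtype.ext (mul_comm x a)⟩
  let i : ResidueField R' →ₗ[R'] Q := Submodule.liftQ (maximalIdeal R') _ hi
  refine hasProjectiveDimensionLE_of_retract i r ?_ h
  have h1 : r q = 1 := by
    change ρ (φ v) = 1
    rw [hφ]
    exact map_one (algebraMap R (ResidueField R'))
  ext a
  obtain ⟨a, rfl⟩ := residue_surjective a
  change r (a • q) = residue R' a
  rw [map_smul, h1, Algebra.smul_def, mul_one, ResidueField.algebraMap_eq]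

end ModuleCat

/-! ### Serre's criterion and localization -/

namespace IsRegularLocalRing

open ModuleCat

lemma of_hasProjectiveDimensionLE_of_spanFinrank_eq (d : ℕ) :
    ∀ (R : Type u) [CommRing R] [IsLocalRing R] [IsNoetherianRing R],
      (maximalIdeal R).spanFinrank = d → ∀ n,
        HasProjectiveDimensionLE (of R (ResidueField R)) n → IsRegularLocalRing R := by
  induction d with
  | zero =>
    intro R _ _ _ h n hn
    have hm : maximalIdeal R = ⊥ := (Submodule.spanFinrank_eq_zero_iff_eq_bot
      (maximalIdeal R).fg_of_isNoetherianRing).mp h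
    let := (IsLocalRing.isField_iff_maximalIdeal_eq.mpr hm).toField
    infer_instance
  | succ d ih =>
    intro R _ _ _ h n hn
    have hm : maximalIdeal R ≠ ⊥ := fun h0 ↦ by simp [h0] at h
    -- In depth zero the residue field would be projective, hence faithful, yet `𝔪 ≠ 0` kills it.
    have hass : maximalIdeal R ∉ associatedPrimes R R := by
      intro hass
      obtain ⟨-, z, hz⟩ := isAssociatedPrime_iff.mp hass
      have hz0 : z ≠ 0 := by
        rintro rfl
        exact (maximalIdeal.isMaximal R).ne_top (by
          rw [hz, eq_top_iff]
          exact fun a _ ↦ Submodule.mem_colon_singleton.mpr (by simp))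
      have hzm : ∀ a ∈ maximalIdeal R, z * a = 0 := fun a ha ↦ by
        rw [hz, Submodule.mem_colon_singleton] at ha
        simpa [mul_comm] using ha
      have : Module.Projective R (ResidueField R) :=
        projective_of_hasProjectiveDimensionLE_of_socle_ne_zero hz0 hzm n (ResidueField R) hn
      have : Nontrivial (ResidueField R) :=
        Ideal.Quotient.nontrivial_iff.mpr (maximalIdeal.isMaximal R).ne_top
      refine hm (le_bot_iff.mp ?_)
      rw [← Module.annihilator_eq_bot_of_projective (R := R) (ResidueField R)]
      intro a ha
      refine Module.mem_annihilator.mpr fun y ↦ ?_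
      rw [Algebra.smul_def, ResidueField.algebraMap_eq, (residue_eq_zero_iff a).mpr ha, zero_mul]
    obtain ⟨x, hx, hx2, hxq⟩ := exists_mem_maximalIdeal_notMem_sq hm
      (associatedPrimes.finite R R) (fun q hq ↦ hq.isPrime) hass
    have hreg : x ∈ nonZeroDivisors R := by
      by_contra hx0
      have h0 : x ∈ ⋃ p ∈ associatedPrimes R R, (p : Set R) := by
        rw [biUnion_associatedPrimes_eq_compl_nonZeroDivisors]
        exact hx0
      obtain ⟨q, hq, hqx⟩ := Set.mem_iUnion₂.mp h0
      exact hxq q hq hqx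
    have := IsLocalRing.quotient_span_singleton hx
    have hxm : IsSMulRegular (maximalIdeal R) x :=
      IsSMulRegular.submodule (M := R) _ _ (Module.Flat.isSMulRegular_of_nonZeroDivisors hreg)
    have hpd := hasProjectiveDimensionLE_residueField_quotient hx hx2
      ((hasProjectiveDimensionLE_quotSMulTop_iff hx hreg n _ hxm).mpr
        (hasProjectiveDimensionLE_maximalIdeal hn))
    have := ih (R ⧸ Ideal.span {x}) (by
      have h1 := spanFinrank_maximalIdeal_quotient_add_one_le hx hx2
      have h2 := spanFinrank_maximalIdeal_le_quotient_add_one hx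
      omega) n hpd
    exact of_quotient_span_singleton hx hreg

/-- **Serre**: a Noetherian local ring whose residue field has finite projective dimension is
regular. -/
theorem of_hasProjectiveDimensionLE_residueField {R : Type u} [CommRing R] [IsLocalRing R]
    [IsNoetherianRing R] {n : ℕ} (h : HasProjectiveDimensionLE (of R (ResidueField R)) n) :
    IsRegularLocalRing R :=
  of_hasProjectiveDimensionLE_of_spanFinrank_eq _ R rfl n h

/-- Localizations of regular local rings at primes are regular. -/
theorem localization_atPrime {R : Type u} [CommRing R] [IsRegularLocalRing R] (𝔭 : Ideal R)
    [𝔭.IsPrime] : IsRegularLocalRing (Localization.AtPrime 𝔭) := by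
  have : IsNoetherianRing (Localization.AtPrime 𝔭) :=
    IsLocalization.isNoetherianRing 𝔭.primeCompl _ inferInstance
  obtain ⟨n, hn⟩ := exists_hasProjectiveDimensionLE_of_isRegularLocalRing _ R rfl (R ⧸ 𝔭)
  have hloc := localizedModule_hasProjectiveDimensionLE n 𝔭.primeCompl (of R (R ⧸ 𝔭))
  -- Localizing `R ⧸ 𝔭` at `𝔭` inverts all its nonzero elements, so the result is its fraction field
  -- `𝔭.ResidueField`.
  have hS : Algebra.algebraMapSubmonoid (R ⧸ 𝔭) 𝔭.primeCompl = nonZeroDivisors (R ⧸ 𝔭) := by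
    ext a
    obtain ⟨a, rfl⟩ := Ideal.Quotient.mk_surjective a
    rw [mem_nonZeroDivisors_iff_ne_zero, ne_eq, Ideal.Quotient.eq_zero_iff_mem]
    refine ⟨?_, fun ha ↦ ⟨a, ha, rfl⟩⟩
    rintro ⟨b, hb, hba⟩ ha
    refine hb ?_
    have h1 : Ideal.Quotient.mk 𝔭 b = Ideal.Quotient.mk 𝔭 a := hba
    exact Ideal.Quotient.eq_zero_iff_mem.mp (h1.trans (Ideal.Quotient.eq_zero_iff_mem.mpr ha))
  have : IsLocalization (Algebra.algebraMapSubmonoid (R ⧸ 𝔭) 𝔭.primeCompl) 𝔭.ResidueField := by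
    rw [hS]
    infer_instance
  have := (of R (R ⧸ 𝔭)).localizedModule_isLocalizedModule 𝔭.primeCompl
  let e := (IsLocalizedModule.linearEquiv 𝔭.primeCompl
    ((of R (R ⧸ 𝔭)).localizedModuleMkLinearMap 𝔭.primeCompl)
    (IsScalarTower.toAlgHom R (R ⧸ 𝔭) 𝔭.ResidueField).toLinearMap).extendScalarsOfIsLocalization
      𝔭.primeCompl (Localization.AtPrime 𝔭)
  exact of_hasProjectiveDimensionLE_residueField 
    (ModuleCat.hasProjectiveDimensionLE_of_linearEquiv e n)

end IsRegularLocalRing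

theorem mainTheorem8 {R : Type*} [CommRing R] [IsRegularLocalRing R]
    (p : ℕ) [Fact p.Prime] [CharP (IsLocalRing.ResidueField R) p]
    (𝔭 : Ideal R) [𝔭.IsPrime] (hp : (p : R) ∈ 𝔭) :
    IsRegularLocalRing (Localization.AtPrime 𝔭) :=
  IsRegularLocalRing.localization_atPrime 𝔭
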